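/- Let $q\ge 2$ be an integer. A $q$-ary $m\times n$ matrix (entries in $\{0,1,\dots,q-1\}$; $m,n\ge 0$) is a (strong) lonesum matrix if it is the only $q$-ary $m\times n$ matrix with its row sums and column sums; let $B_m^{(-n)}(q)$ be the number of $q$-ary lonesum $m\times n$ matrices (equal to $1$ if $m=0$ or $n=0$). Put $$f_q(r,s)=1+(q-2)rs+r\big((q-1)^s-(q-2)s-1\big)+s\big((q-1)^r-(q-2)r-1\big),$$ $$F_q(x,y)=1-e^x-e^y+\big(1-x-y-(q-2)xy+xe^{(q-2)y}+ye^{(q-2)x}\big)e^{x+y}.$$ Then the following identities of formal power series over $\mathbb{Q}$ hold. (a) $F_q(x,y)=\sum_{r,s\ge 1} f_q(r,s)\frac{x^r}{r!}\frac{y^s}{s!}$; the series $1-F_q(x,y)$ is invertible, and $$\sum_{m,n\ge 0} B_m^{(-n)}(q)\frac{x^m}{m!}\frac{y^n}{n!}=\frac{e^{x+y}}{1-F_q(x,y)}.$$ (b) For every integer $k\ge 0$, $$\sum_{m\ge 0} B_m^{(-k)}(q)\frac{x^m}{m!}=\sum_{\substack{0\le l_3\le k\\ l_1,l_2,l_4\ge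 0}} l_3!\binom{l_1+l_2+l_3+l_4}{l_1,l_2,l_3,l_4}\binom{k}{l_3}\big(1+l_2+l_3+(q-1)l_4\big)^{k-l_3}(1-e^x)^{l_1}(-1+e^x-xe^x)^{l_2}\big(-1-(q-2)x+e^{(q-2)x}\big)^{l_3}x^{l_4}e^{(l_3+l_4+1)x},$$ where for each $N$ only finitely many terms on the right contribute to the coefficient of $x^N$. (c) For $q=2$ these specialise to Kaneko's formulas: $1-F_2(x,y)=e^x+e^y-e^{x+y}$, so that $$\sum_{m,n\ge 0} B_m^{(-n)}(2)\frac{x^m}{m!}\frac{y^n}{n!}=\frac{e^{x+y}}{e^x+e^y-e^{x+y}},$$ and, for all $m,n\ge 0$, $B_m^{(-n)}(2)$ is the poly-Bernoulli number $B_m^{(-n)}$, defined for $n\in\mathbb{Z}$ by $\frac{Li_n(1-e^{-x})}{1-e^{-x}}=\sum_{m\ge 0}B_m^{(n)}\frac{x^m}{m!}$ with $Li_n(z)=\sum_{l\ge 1}z^l/l^n$. -/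

import Mathlib

open scoped Nat

/-- A `q`-ary `m × n` matrix (entries in `{0, 1, …, q - 1}`) is a (strong) lonesum matrix if it is
the only `q`-ary `m × n` matrix with its row sums and column sums. -/
def IsLonesum {q m n : ℕ} (M : Matrix (Fin m) (Fin n) (Fin q)) : Prop :=
  ∀ M' : Matrix (Fin m) (Fin n) (Fin q),
    (∀ i, ∑ j, (M' i j : ℕ) = ∑ j, (M i j : ℕ)) →
    (∀ j, ∑ i, (M' i j : ℕ) = ∑ i, (M i j : ℕ)) → M' = M

/-- `B_m^{(-n)}(q)`: the number of `q`-ary lonesum `m × n` matrices. -/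
noncomputable def lonesumCount (q m n : ℕ) : ℕ :=
  Nat.card {M : Matrix (Fin m) (Fin n) (Fin q) // IsLonesum M}

/-- The formal power series `e^{a x + b y}` in the two variables `x = X 0`, `y = X 1`. -/
noncomputable def expXY (a b : ℚ) : MvPowerSeries (Fin 2) ℚ :=
  (PowerSeries.exp ℚ).subst
    (MvPowerSeries.C a * MvPowerSeries.X 0 + MvPowerSeries.C b * MvPowerSeries.X 1 :
      MvPowerSeries (Fin 2) ℚ)

/-- `∑_{m,n} B_m^{(-n)}(q) x^m/m! y^n/n!`, given by its coefficients. -/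
noncomputable def lonesumEGF (q : ℕ) : MvPowerSeries (Fin 2) ℚ :=
  fun d => (lonesumCount q (d 0) (d 1) : ℚ) / ((d 0)! * (d 1)!)

/-- `F_q(x,y) = 1 - e^x - e^y + (1 - x - y - (q-2)xy + x e^{(q-2)y} + y e^{(q-2)x}) e^{x+y}`. -/
noncomputable def lonesumF (q : ℕ) : MvPowerSeries (Fin 2) ℚ :=
  let x : MvPowerSeries (Fin 2) ℚ := MvPowerSeries.X 0
  let y : MvPowerSeries (Fin 2) ℚ := MvPowerSeries.X 1
  let c : ℚ := (q : ℚ) - 2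
  1 - expXY 1 0 - expXY 0 1 +
    (1 - x - y - MvPowerSeries.C c * x * y + x * expXY 0 c + y * expXY c 0) * expXY 1 1

/-- `f_q(r,s) = 1 + (q-2)rs + r((q-1)^s - (q-2)s - 1) + s((q-1)^r - (q-2)r - 1)`. -/
def blockCount (q r s : ℕ) : ℚ :=
  1 + ((q : ℚ) - 2) * r * s + r * (((q : ℚ) - 1) ^ s - ((q : ℚ) - 2) * s - 1)
    + s * (((q : ℚ) - 1) ^ r - ((q : ℚ) - 2) * r - 1)

/-- The formal power series `e^{c x}` in one variable. -/
noncomputable def expX (c : ℚ) : PowerSeries ℚ :=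
  PowerSeries.rescale c (PowerSeries.exp ℚ)

/-- Formal (coefficientwise finite) summation of a family of power series. -/
def FormalHasSum {ι : Type} (f : ι → PowerSeries ℚ) (s : PowerSeries ℚ) : Prop :=
  ∀ N : ℕ, (Function.support fun i => PowerSeries.coeff N (f i)).Finite ∧
    ∑ᶠ i, PowerSeries.coeff N (f i) = PowerSeries.coeff N s

/-- With `l = (l₁, l₂, l₃, l₄)`, the series
`l₃! (l₁+l₂+l₃+l₄ choose l₁,l₂,l₃,l₄) (k choose l₃) (1 + l₂ + l₃ + (q-1)l₄)^{k-l₃}`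
`(1-e^x)^{l₁} (-1+e^x-xe^x)^{l₂} (-1-(q-2)x+e^{(q-2)x})^{l₃} x^{l₄} e^{(l₃+l₄+1)x}`;
it is used for `l₃ ≤ k` only. -/
noncomputable def expansionTerm (q k : ℕ) (l : Fin 4 → ℕ) : PowerSeries ℚ :=
  let x : PowerSeries ℚ := PowerSeries.X
  let c : ℚ := (q : ℚ) - 2
  PowerSeries.C (((l 2)! : ℚ) * (Nat.multinomial Finset.univ l : ℚ) * (k.choose (l 2) : ℚ)
      * (1 + (l 1 : ℚ) + (l 2 : ℚ) + ((q : ℚ) - 1) * (l 3 : ℚ)) ^ (k - l 2))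
    * (1 - expX 1) ^ l 0
    * (-1 + expX 1 - x * expX 1) ^ l 1
    * (-1 - PowerSeries.C c * x + expX c) ^ l 2
    * x ^ l 3
    * expX ((l 2 : ℚ) + (l 3 : ℚ) + 1)

/-- The polylogarithm `Li_n(z) = ∑_{l ≥ 1} z^l / l^n`, `n ∈ ℤ`, as a formal power series. -/
noncomputable def polylog (n : ℤ) : PowerSeries ℚ :=
  PowerSeries.mk fun l => if l = 0 then 0 else 1 / (l : ℚ) ^ n

/-- The formal power series `Li_n(1 - e^{-x}) / (1 - e^{-x})`: substitute `1 - e^{-x}` for `z` in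
the power series `Li_n(z) / z`. -/
noncomputable def polyBernoulliSeries (n : ℤ) : PowerSeries ℚ :=
  (PowerSeries.mk fun l => PowerSeries.coeff (l + 1) (polylog n)).subst (1 - expX (-1))

/-- `polyBernoulliSeries n` is the quotient of `Li_n(1 - e^{-x})` by `1 - e^{-x}`. -/
theorem mul_polyBernoulliSeries (n : ℤ) :
    (1 - expX (-1)) * polyBernoulliSeries n = (polylog n).subst (1 - expX (-1)) := by
  have h : PowerSeries.HasSubst (1 - expX (-1)) := by
    apply PowerSeries.HasSubst.of_constantCoeff_zero'
    rw [map_sub, map_one, expX, ← PowerSeries.coeff_zero_eq_constantCoeff_apply,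
      PowerSeries.coeff_rescale]
    simp
  have hX : polylog n = PowerSeries.X *
      PowerSeries.mk fun l => PowerSeries.coeff (l + 1) (polylog n) := by
    ext l
    cases l with
    | zero => simp [polylog]
    | succ l => rw [PowerSeries.coeff_succ_X_mul, PowerSeries.coeff_mk]
  conv_rhs => rw [hX]
  rw [PowerSeries.subst_mul h, PowerSeries.subst_X h, polyBernoulliSeries]

/-- Kaneko's poly-Bernoulli number `B_m^{(n)}`:
`Li_n(1 - e^{-x}) / (1 - e^{-x}) = ∑_m B_m^{(n)} x^m / m!`. -/
noncomputable def polyBernoulli (m : ℕ) (n : ℤ) : ℚ :=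
  (m ! : ℚ) * PowerSeries.coeff m (polyBernoulliSeries n)

/-!
# Lonesum matrices over `{0, …, q - 1}` and their generating function

A matrix is lonesum exactly if it is switch-free: no `2 × 2` minor can be changed by adding `1` on
one diagonal and subtracting `1` on the other. A switch preserves the margins; conversely, if some
other matrix has the same margins, then following the signs of the differences from a row of maximal
weight (the number of nonzero entries plus the number of entries `q - 1`) leads to a contradiction
(`SwitchFree.isLonesum`).

The supports of the rows of a switch-free matrix form a chain. Let `S` be the set of columns without
zeros in the nonzero rows, and `R` the set of nonzero rows supported on `S`. A nonzero switch-free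
matrix has a block without zeros on `R × S`, vanishes on `R × Sᶜ`, and its entries on `Rᶜ × S` are
`q - 1` in the nonzero rows and `0` in the others. So it amounts to the choice of `R` and `S`, of a
zero-free switch-free block, and of an arbitrary switch-free matrix on `Rᶜ × Sᶜ` (`peelEquiv`). In a
zero-free switch-free block the entries other than `q - 1` lie in a single row or a single column,
and inclusion–exclusion gives the number `f_q(r,s)` of such blocks (`card_noGeneralPair`). The
resulting recursion `lonesumCount_recursion` is the identity `(1 - F_q) G = e^{x+y}` for the
generating function `G`.

The other formulas come from expanding `G = ∑ F ^ N E`, which is legitimate since `F` is divisible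
by `x` (`coeff_eq_sum_of_one_sub_mul_eq`). For fixed `k` one uses that `F_q` is a sum of four
products `g(x) h(y)` (`lonesumF_eq_sum`) and the multinomial theorem; for `q = 2` one rewrites `G` as
`e^y / (1 - (1 - e^{-x}) e^y)` and compares with the definition of the poly-Bernoulli numbers.
-/

/-! ### Switch-free matrices -/

/-- A matrix over `{0, …, p + 1}` is switch-free if no `2 × 2` minor can be changed by adding `1` on
one diagonal and subtracting `1` on the other one. The number `q = p + 2` of values is written in
this way so that `0` and the maximum `Fin.last` are available. -/
def SwitchFree {p : ℕ} {α β : Type*} (M : α → β → Fin (p + 2)) : Prop :=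
  ∀ ⦃i i' j j'⦄, i ≠ i' → j ≠ j' → M i j ≠ Fin.last _ → M i' j' ≠ Fin.last _ →
    M i j' ≠ 0 → M i' j ≠ 0 → False

theorem IsLonesum.switchFree {p m n : ℕ} {M : Matrix (Fin m) (Fin n) (Fin (p + 2))}
    (hM : IsLonesum M) : SwitchFree M := by
  intro i i' j j' hi hj h1 h2 h3 h4
  have h1' := Fin.val_lt_last h1
  have h2' := Fin.val_lt_last h2
  have h3' : 0 < (M i j' : ℕ) := Nat.pos_of_ne_zero fun h => h3 (Fin.ext h)
  have h4' : 0 < (M i' j : ℕ) := Nat.pos_of_ne_zero fun h => h4 (Fin.ext h)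
  -- the switched matrix, as a matrix of natural numbers
  let N : Fin m → Fin n → ℕ := fun a b =>
    if a = i ∧ b = j then M i j + 1 else if a = i' ∧ b = j' then M i' j' + 1 else
    if a = i ∧ b = j' then M i j' - 1 else if a = i' ∧ b = j then M i' j - 1 else M a b
  have hN : ∀ a b, N a b < p + 2 := by
    intro a b
    have := (M a b).isLt
    simp only [N]
    split_ifs <;> omega
  have hZ : ∀ a b, (N a b : ℤ) = M a b +
      ((if a = i then 1 else 0) - (if a = i' then 1 else 0)) *
      ((if b = j then 1 else 0) - (if b = j' then 1 else 0)) := by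
    intro a b
    simp only [N]
    by_cases ha : a = i
    · subst ha
      by_cases hb : b = j
      · subst hb; simp [hi, hj]
      · by_cases hb' : b = j'
        · subst hb'; simp [hi, hb]; omega
        · simp [hb, hb']
    · by_cases ha' : a = i'
      · subst ha'
        by_cases hb : b = j
        · subst hb; simp [hi.symm, hj]; omega
        · by_cases hb' : b = j'
          · subst hb'; simp [hi.symm, hb]
          · simp [hb, hb']
      · simp [ha, ha']
  have key := hM (fun a b => ⟨N a b, hN a b⟩) (fun a => by
      zify
      simp only [hZ, Finset.sum_add_distrib, ← Finset.mul_sum, Finset.sum_sub_distrib,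
        Finset.sum_ite_eq', Finset.mem_univ, if_true]
      ring) (fun b => by
      zify
      simp only [hZ, Finset.sum_add_distrib, ← Finset.sum_mul, Finset.sum_sub_distrib,
        Finset.sum_ite_eq', Finset.mem_univ, if_true]
      ring)
  have := congrArg Fin.val (congrFun (congrFun key i) j)
  simp [N] at this

/-- The number of nonzero entries plus the number of entries equal to the maximum, in a row. -/
def rowWeight {p : ℕ} {α β : Type*} [Fintype β] (M : α → β → Fin (p + 2)) (i : α) : ℕ :=
  ∑ j, ((if M i j ≠ 0 then 1 else 0) + if M i j = Fin.last _ then 1 else 0)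

/-- In a switch-free matrix, a row that could give away a unit in a column in which another row could
take one has at least the weight of the latter; equality forces the entries of the former outside
that column to be extreme, and the entry of the latter in that column to be intermediate. -/
theorem SwitchFree.rowWeight_le {p : ℕ} {α β : Type*} [Fintype β]
    {M : α → β → Fin (p + 2)} (hM : SwitchFree M) {i i' : α} {j : β} (hi : i ≠ i')
    (h1 : M i j ≠ Fin.last _) (h2 : M i' j ≠ 0) :
    rowWeight M i ≤ rowWeight M i' ∧ (rowWeight M i = rowWeight M i' →
      M i j ≠ 0 ∧ ∀ j', j' ≠ j → M i' j' = 0 ∨ M i' j' = Fin.last _) := by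
  classical
  have h0 : (0 : Fin (p + 2)) ≠ Fin.last _ := (Fin.last_pos).ne
  have hle : ∀ b ∈ Finset.univ,
      ((if M i b ≠ 0 then 1 else 0) + if M i b = Fin.last _ then 1 else 0) ≤
      ((if M i' b ≠ 0 then 1 else 0) + if M i' b = Fin.last _ then 1 else 0) := by
    intro b _
    by_cases hb : b = j
    · subst hb
      simp only [h1]
      split_ifs <;> simp_all
    · by_cases hz : M i b = 0
      · simp [hz, h0]
      · have : M i' b = Fin.last _ := by
          by_contra hl
          exact hM hi (Ne.symm hb) h1 hl hz h2
        rw [this]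
        split_ifs <;> simp_all
  refine ⟨Finset.sum_le_sum hle, fun heq => ?_⟩
  have heq' := (Finset.sum_eq_sum_iff_of_le hle).1 heq
  refine ⟨fun hz => ?_, fun b hb => ?_⟩
  · have := heq' j (Finset.mem_univ _)
    simp only [hz, h0, h2, ne_eq, not_true_eq_false, not_false_eq_true, if_true, if_false] at this
    omega
  · by_cases hz : M i b = 0
    · have := heq' b (Finset.mem_univ _)
      left
      by_contra hne
      simp only [hz, h0, hne, ne_eq, not_true_eq_false, not_false_eq_true, if_true,
        if_false] at this
      omega
    · right
      by_contra hl
      exact hM hi (Ne.symm hb) h1 hl hz h2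

theorem exists_neg_of_sum_eq_zero {ι : Type*} [Fintype ι] {f : ι → ℤ} (h : ∑ i, f i = 0) {i : ι}
    (hi : 0 < f i) : ∃ k, f k < 0 := by
  by_contra! hf
  exact hi.ne' ((Finset.sum_eq_zero_iff_of_nonneg fun k _ => hf k).1 h i (Finset.mem_univ _))

/-- If another matrix had the same margins, follow the differences from a row of maximal weight
among the rows that differ: two consecutive steps contradict the equality case of
`SwitchFree.rowWeight_le`. -/
theorem SwitchFree.isLonesum {p m n : ℕ} {M : Matrix (Fin m) (Fin n) (Fin (p + 2))}
    (hM : SwitchFree M) : IsLonesum M := by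
  classical
  intro M' hr hc
  let D : Fin m → Fin n → ℤ := fun i j => (M' i j : ℤ) - M i j
  have hDr : ∀ i, ∑ j, D i j = 0 := fun i => by
    have := hr i
    zify at this
    simp [D, Finset.sum_sub_distrib, this]
  have hDc : ∀ j, ∑ i, D i j = 0 := fun j => by
    have := hc j
    zify at this
    simp [D, Finset.sum_sub_distrib, this]
  have hpos : ∀ {i j}, 0 < D i j → M i j ≠ Fin.last _ := fun {i j} h h' => by
    have := (M' i j).isLt
    simp only [D, h', Fin.val_last] at h
    omega
  have hneg : ∀ {i j}, D i j < 0 → M i j ≠ 0 := fun {i j} h h' => by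
    simp only [D, h', Fin.val_zero] at h
    omega
  by_contra hne
  have hex : ∃ i, ∃ j, 0 < D i j := by
    by_contra! hle
    refine hne (funext fun i => funext fun j => ?_)
    have := (Finset.sum_eq_zero_iff_of_nonpos fun k _ => hle i k).1 (hDr i) j (Finset.mem_univ _)
    simp only [D] at this
    exact Fin.ext (by omega)
  obtain ⟨i, hi, hmax⟩ := Finset.exists_max_image
    (Finset.univ.filter fun i => ∃ j, 0 < D i j) (rowWeight M)
    (by obtain ⟨i, hi⟩ := hex; exact ⟨i, by simpa using hi⟩)
  simp only [Finset.mem_filter, Finset.mem_univ, true_and] at hi hmax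
  -- one step: a positive difference leads to another row, of the same weight
  have step : ∀ a b, 0 < D a b → rowWeight M a = rowWeight M i → ∃ a', D a' b < 0 ∧
      (∃ b', 0 < D a' b') ∧ rowWeight M a' = rowWeight M i ∧ M a b ≠ 0 ∧
      ∀ b', b' ≠ b → M a' b' = 0 ∨ M a' b' = Fin.last _ := by
    intro a b hab hw
    obtain ⟨a', ha'⟩ := exists_neg_of_sum_eq_zero (hDc b) hab
    have hne : a ≠ a' := by rintro rfl; omega
    obtain ⟨b', hb'⟩ := exists_neg_of_sum_eq_zero (f := fun k => - D a' k) (i := b)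
      (by simp [hDr a']) (by omega)
    have hex' : ∃ b', 0 < D a' b' := ⟨b', by omega⟩
    obtain ⟨h1, h2⟩ := hM.rowWeight_le hne (hpos hab) (hneg ha')
    have hw' : rowWeight M a = rowWeight M a' := le_antisymm h1 (hw ▸ hmax a' hex')
    exact ⟨a', ha', hex', hw' ▸ hw, h2 hw'⟩
  obtain ⟨j, hj⟩ := hi
  obtain ⟨i', h1, ⟨j', hj'⟩, h3, -, h4⟩ := step i j hj rfl
  have hjj : j' ≠ j := by rintro rfl; omega
  obtain ⟨-, -, -, -, h5, -⟩ := step i' j' hj' h3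
  exact (h4 j' hjj).elim h5 (hpos hj')

theorem isLonesum_iff_switchFree {p m n : ℕ} {M : Matrix (Fin m) (Fin n) (Fin (p + 2))} :
    IsLonesum M ↔ SwitchFree M :=
  ⟨IsLonesum.switchFree, SwitchFree.isLonesum⟩

theorem SwitchFree.comp {p : ℕ} {α β α' β' : Type*} {M : α → β → Fin (p + 2)} (hM : SwitchFree M)
    {f : α' → α} {g : β' → β} (hf : f.Injective) (hg : g.Injective) :
    SwitchFree fun i j => M (f i) (g j) :=
  fun _ _ _ _ hi hj => hM (hf.ne hi) (hg.ne hj)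

theorem card_switchFree {p : ℕ} (α β : Type*) [Fintype α] [Fintype β] :
    Nat.card {M : α → β → Fin (p + 2) // SwitchFree M} =
      lonesumCount (p + 2) (Fintype.card α) (Fintype.card β) := by
  let e := Fintype.equivFin α
  let f := Fintype.equivFin β
  refine Nat.card_congr ((Equiv.arrowCongr e (Equiv.arrowCongr f (Equiv.refl _))).subtypeEquiv
    fun M => ?_)
  refine Iff.trans ⟨fun h => ?_, fun h => ?_⟩ isLonesum_iff_switchFree.symm
  · exact h.comp e.symm.injective f.symm.injective
  · simpa [Equiv.arrowCongr] using h.comp e.injective f.injective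

/-! ### Peeling off the first block -/

section Peel

variable {p : ℕ} {α β : Type*}

open Classical in
/-- The matrix with block `W` on `R × S` and block `M'` on the product of the complements; it
vanishes on `R × Sᶜ`, and on `Rᶜ × S` its entry is the maximum in the nonzero rows of `M'` and `0`
in the other ones. -/
noncomputable def glue (R : Finset α) (S : Finset β) (W : R → S → Fin (p + 2))
    (M' : {i // i ∉ R} → {j // j ∉ S} → Fin (p + 2)) : α → β → Fin (p + 2) := fun i j =>
  if hi : i ∈ R then if hj : j ∈ S then W ⟨i, hi⟩ ⟨j, hj⟩ else 0
  else if hj : j ∈ S then if ∃ b, M' ⟨i, hi⟩ b ≠ 0 then Fin.last _ else 0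
  else M' ⟨i, hi⟩ ⟨j, hj⟩

variable {R : Finset α} {S : Finset β} {W : R → S → Fin (p + 2)}
  {M' : {i // i ∉ R} → {j // j ∉ S} → Fin (p + 2)}

theorem glue_mem_mem {i : α} {j : β} (hi : i ∈ R) (hj : j ∈ S) :
    glue R S W M' i j = W ⟨i, hi⟩ ⟨j, hj⟩ := by simp [glue, hi, hj]

theorem glue_mem_notMem {i : α} {j : β} (hi : i ∈ R) (hj : j ∉ S) : glue R S W M' i j = 0 := by
  simp [glue, hi, hj]

theorem glue_notMem_notMem {i : α} {j : β} (hi : i ∉ R) (hj : j ∉ S) :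
    glue R S W M' i j = M' ⟨i, hi⟩ ⟨j, hj⟩ := by simp [glue, hi, hj]

theorem glue_notMem_mem {i : α} {j : β} (hi : i ∉ R) (hj : j ∈ S) {b : {j // j ∉ S}}
    (h : M' ⟨i, hi⟩ b ≠ 0) : glue R S W M' i j = Fin.last _ := by
  have : ∃ b, M' ⟨i, hi⟩ b ≠ 0 := ⟨b, h⟩
  simp only [glue, hi, hj, dif_pos, dif_neg, not_false_eq_true]
  rw [if_pos this]

theorem exists_of_glue_ne_zero {i : α} {j : β} (hi : i ∉ R) (h : glue R S W M' i j ≠ 0) :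
    ∃ b, M' ⟨i, hi⟩ b ≠ 0 := by
  by_contra h'
  by_cases hj : j ∈ S
  · simp only [glue, hi, hj, dif_pos, dif_neg, not_false_eq_true] at h
    rw [if_neg h'] at h
    exact h rfl
  · exact h' ⟨⟨j, hj⟩, by rwa [glue_notMem_notMem hi hj] at h⟩

theorem SwitchFree.glue (hW : SwitchFree W) (hM' : SwitchFree M') :
    SwitchFree (glue R S W M') := by
  have key : ∀ {i j j'}, i ∉ R → j ∈ S → _root_.glue R S W M' i j ≠ Fin.last _ →
      _root_.glue R S W M' i j' ≠ 0 → False := fun {i j j'} hi hj h1 h2 => by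
    obtain ⟨b, hb⟩ := exists_of_glue_ne_zero hi h2
    exact h1 (glue_notMem_mem hi hj hb)
  have hS : ∀ {i j}, i ∈ R → _root_.glue R S W M' i j ≠ 0 → j ∈ S := fun hi h =>
    by_contra fun hj => h (glue_mem_notMem hi hj)
  intro i i' j j' hi hj h1 h2 h3 h4
  by_cases hiR : i ∈ R
  · by_cases hiR' : i' ∈ R
    · have hj1 := hS hiR h3
      have hj2 := hS hiR' h4
      rw [glue_mem_mem hiR hj2] at h1
      rw [glue_mem_mem hiR' hj1] at h2
      rw [glue_mem_mem hiR hj1] at h3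
      rw [glue_mem_mem hiR' hj2] at h4
      exact hW (by simpa using hi) (by simpa using hj) h1 h2 h3 h4
    · exact key hiR' (hS hiR h3) h2 h4
  · by_cases hiR' : i' ∈ R
    · exact key hiR (hS hiR' h4) h1 h3
    · by_cases hj1 : j ∈ S
      · exact key hiR hj1 h1 h3
      · by_cases hj2 : j' ∈ S
        · exact key hiR' hj2 h2 h4
        · rw [glue_notMem_notMem hiR hj1] at h1
          rw [glue_notMem_notMem hiR' hj2] at h2
          rw [glue_notMem_notMem hiR hj2] at h3
          rw [glue_notMem_notMem hiR' hj1] at h4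
          exact hM' (by simpa using hi) (by simpa using hj) h1 h2 h3 h4

theorem glue_ne_zero (hR : R.Nonempty) (hS : S.Nonempty) (hW : ∀ i j, W i j ≠ 0) :
    glue R S W M' ≠ 0 := by
  obtain ⟨i, hi⟩ := hR
  obtain ⟨j, hj⟩ := hS
  intro h
  have := congrFun (congrFun h i) j
  rw [glue_mem_mem hi hj] at this
  exact hW _ _ this

variable [Fintype β]

open Classical in
/-- The columns that are nonzero in every nonzero row. -/
noncomputable def peelCols (M : α → β → Fin (p + 2)) : Finset β :=
  Finset.univ.filter fun j => ∀ i, (∃ j', M i j' ≠ 0) → M i j ≠ 0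

theorem mem_peelCols {M : α → β → Fin (p + 2)} {j : β} :
    j ∈ peelCols M ↔ ∀ i, (∃ j', M i j' ≠ 0) → M i j ≠ 0 := by
  simp [peelCols]

theorem peelCols_glue (hR : R.Nonempty) (hS : S.Nonempty) (hW : ∀ i j, W i j ≠ 0) :
    peelCols (glue R S W M') = S := by
  ext j
  rw [mem_peelCols]
  refine ⟨fun h => ?_, fun hj i ⟨j', h⟩ => ?_⟩
  · obtain ⟨i, hi⟩ := hR
    obtain ⟨j', hj'⟩ := hS
    by_contra hj
    exact h i ⟨j', by rw [glue_mem_mem hi hj']; exact hW _ _⟩ (glue_mem_notMem hi hj)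
  · by_cases hi : i ∈ R
    · rw [glue_mem_mem hi hj]; exact hW _ _
    · obtain ⟨b, hb⟩ := exists_of_glue_ne_zero hi h
      rw [glue_notMem_mem hi hj hb]
      exact (Fin.last_pos).ne'

variable [Fintype α]

open Classical in
/-- The nonzero rows supported on `peelCols M`. -/
noncomputable def peelRows (M : α → β → Fin (p + 2)) : Finset α :=
  Finset.univ.filter fun i => (∃ j, M i j ≠ 0) ∧ ∀ j, M i j ≠ 0 → j ∈ peelCols M

theorem mem_peelRows {M : α → β → Fin (p + 2)} {i : α} :
    i ∈ peelRows M ↔ (∃ j, M i j ≠ 0) ∧ ∀ j, M i j ≠ 0 → j ∈ peelCols M := by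
  simp [peelRows]

/-- The support of a switch-free matrix has nested rows, so that a nonzero row of smallest support
is supported on `peelCols M`. -/
theorem SwitchFree.peelRows_nonempty {M : α → β → Fin (p + 2)} (hM : SwitchFree M) (h0 : M ≠ 0) :
    (peelRows M).Nonempty := by
  classical
  have hl : (0 : Fin (p + 2)) ≠ Fin.last _ := (Fin.last_pos).ne
  have hne : (Finset.univ.filter fun i => ∃ j, M i j ≠ 0).Nonempty := by
    by_contra h
    refine h0 (funext fun i => funext fun j => ?_)
    by_contra hij
    exact h ⟨i, by simpa using ⟨j, hij⟩⟩
  obtain ⟨i, hi, hmin⟩ := Finset.exists_min_image _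
    (fun i => (Finset.univ.filter fun j => M i j ≠ 0).card) hne
  simp only [Finset.mem_filter, Finset.mem_univ, true_and] at hi hmin
  refine ⟨i, mem_peelRows.2 ⟨hi, fun j hj => mem_peelCols.2 fun i' hi' hz => ?_⟩⟩
  have : ∃ j', M i' j' ≠ 0 ∧ M i j' = 0 := by
    by_contra! h
    refine (hmin i' hi').not_gt (Finset.card_lt_card (Finset.ssubset_iff_subset_ne.2 ⟨?_, ?_⟩))
    · intro b hb
      simpa using h b (by simpa using hb)
    · intro heq
      have : j ∈ Finset.univ.filter fun j => M i' j ≠ 0 := heq ▸ by simpa using hj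
      simp [hz] at this
  obtain ⟨j', h1, h2⟩ := this
  refine hM (i := i) (i' := i') (j := j') (j' := j) ?_ ?_ (by rwa [h2]) (by rwa [hz]) hj h1
  · rintro rfl; exact hj hz
  · rintro rfl; exact h1 hz

theorem SwitchFree.peelCols_nonempty {M : α → β → Fin (p + 2)} (hM : SwitchFree M) (h0 : M ≠ 0) :
    (peelCols M).Nonempty := by
  obtain ⟨i, hi⟩ := hM.peelRows_nonempty h0
  obtain ⟨⟨j, hj⟩, h⟩ := mem_peelRows.1 hi
  exact ⟨j, h j hj⟩

theorem ne_zero_of_mem_peel {M : α → β → Fin (p + 2)} {i : α} {j : β} (hi : i ∈ peelRows M)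
    (hj : j ∈ peelCols M) : M i j ≠ 0 :=
  mem_peelCols.1 hj i (mem_peelRows.1 hi).1

theorem eq_zero_of_mem_peelRows {M : α → β → Fin (p + 2)} {i : α} {j : β} (hi : i ∈ peelRows M)
    (hj : j ∉ peelCols M) : M i j = 0 := by
  by_contra h
  exact hj ((mem_peelRows.1 hi).2 j h)

theorem exists_of_notMem_peelRows {M : α → β → Fin (p + 2)} {i : α} {j : β}
    (hi : i ∉ peelRows M) (h : M i j ≠ 0) : ∃ j', j' ∉ peelCols M ∧ M i j' ≠ 0 := by
  by_contra! h'
  exact hi (mem_peelRows.2 ⟨⟨j, h⟩, fun b hb => by_contra fun hb' => hb (h' b hb')⟩)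

theorem SwitchFree.eq_last {M : α → β → Fin (p + 2)} (hM : SwitchFree M) (h0 : M ≠ 0) {i : α}
    {j j' : β} (hi : i ∉ peelRows M) (hj : j ∈ peelCols M) (hj' : j' ∉ peelCols M)
    (h : M i j' ≠ 0) : M i j = Fin.last _ := by
  obtain ⟨i₀, hi₀⟩ := hM.peelRows_nonempty h0
  by_contra hl
  refine hM (i := i₀) (i' := i) (j := j') (j' := j) ?_ ?_ ?_ hl (ne_zero_of_mem_peel hi₀ hj) h
  · rintro rfl; exact hi hi₀
  · rintro rfl; exact hj' hj
  · rw [eq_zero_of_mem_peelRows hi₀ hj']; exact (Fin.last_pos).ne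

theorem peelRows_glue (hR : R.Nonempty) (hS : S.Nonempty) (hW : ∀ i j, W i j ≠ 0) :
    peelRows (glue R S W M') = R := by
  ext i
  rw [mem_peelRows, peelCols_glue hR hS hW]
  refine ⟨fun ⟨⟨j, hj⟩, h⟩ => ?_, fun hi => ⟨?_, fun j hj => ?_⟩⟩
  · by_contra hi
    obtain ⟨b, hb⟩ := exists_of_glue_ne_zero hi hj
    exact b.2 (h b (by rwa [glue_notMem_notMem hi b.2]))
  · obtain ⟨j, hj⟩ := hS
    exact ⟨j, by rw [glue_mem_mem hi hj]; exact hW _ _⟩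
  · by_contra hj'
    exact hj (glue_mem_notMem hi hj')

theorem SwitchFree.glue_peel {M : α → β → Fin (p + 2)} (hM : SwitchFree M) (h0 : M ≠ 0)
    (hR : peelRows M = R) (hS : peelCols M = S) :
    _root_.glue R S (fun i j => M i j) (fun i j => M i j) = M := by
  subst hR hS
  ext1 i; ext1 j
  by_cases hi : i ∈ peelRows M
  · by_cases hj : j ∈ peelCols M
    · rw [glue_mem_mem hi hj]
    · rw [glue_mem_notMem hi hj, eq_zero_of_mem_peelRows hi hj]
  · by_cases hj : j ∈ peelCols M
    · by_cases hz : M i j = 0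
      · rw [hz]
        by_contra h
        obtain ⟨b, hb⟩ := exists_of_glue_ne_zero hi h
        have := hM.eq_last h0 hi hj b.2 hb
        rw [hz] at this
        exact (Fin.last_pos).ne this
      · obtain ⟨j', hj', h⟩ := exists_of_notMem_peelRows hi hz
        rw [hM.eq_last h0 hi hj hj' h, glue_notMem_mem hi hj (b := ⟨j', hj'⟩) h]
    · rw [glue_notMem_notMem hi hj]

/-- The nonzero switch-free matrices whose first block is `R × S` are given by a switch-free matrix
without zeros on `R × S` and a switch-free matrix on the product of the complements. -/
noncomputable def peelEquiv (hR : R.Nonempty) (hS : S.Nonempty) :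
    {M : α → β → Fin (p + 2) // (SwitchFree M ∧ M ≠ 0) ∧ peelRows M = R ∧ peelCols M = S} ≃
      {W : R → S → Fin (p + 2) // SwitchFree W ∧ ∀ i j, W i j ≠ 0} ×
      {M' : {i // i ∉ R} → {j // j ∉ S} → Fin (p + 2) // SwitchFree M'} where
  toFun M :=
    (⟨fun i j => M.1 i j, M.2.1.1.comp Subtype.val_injective Subtype.val_injective, fun i j =>
      ne_zero_of_mem_peel (by rw [M.2.2.1]; exact i.2) (by rw [M.2.2.2]; exact j.2)⟩,
     ⟨fun i j => M.1 i j, M.2.1.1.comp Subtype.val_injective Subtype.val_injective⟩)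
  invFun A := ⟨glue R S A.1.1 A.2.1, ⟨A.1.2.1.glue A.2.2, glue_ne_zero hR hS A.1.2.2⟩,
    peelRows_glue hR hS A.1.2.2, peelCols_glue hR hS A.1.2.2⟩
  left_inv M := Subtype.ext (M.2.1.1.glue_peel M.2.1.2 M.2.2.1 M.2.2.2)
  right_inv A := by
    refine Prod.ext (Subtype.ext ?_) (Subtype.ext ?_)
    · funext i j
      exact glue_mem_mem i.2 j.2
    · funext i j
      exact glue_notMem_notMem i.2 j.2

end Peel

/-! ### Counting the blocks -/

section Block

variable {α β Γ : Type*}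

/-- The nonzero entries of `U` lie in one row or in one column, since no two of them are in
general position. -/
def NoGeneralPair [Zero Γ] (U : α → β → Γ) : Prop :=
  ∀ ⦃i i' j j'⦄, i ≠ i' → j ≠ j' → U i j ≠ 0 → U i' j' ≠ 0 → False

variable [DecidableEq α] [DecidableEq β] [Zero Γ]

theorem noGeneralPair_iff {U : α → β → Γ} : NoGeneralPair U ↔
    U = 0 ∨ (∃ i, ∃ v : β → Γ, v ≠ 0 ∧ Pi.single i v = U) ∨
      ∃ j, ∃ v : α → Γ, v ≠ 0 ∧ (fun a => Pi.single j (v a)) = U := by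
  constructor
  · intro h
    by_cases h0 : ∃ i₀ j₀, U i₀ j₀ ≠ 0
    · obtain ⟨i₀, j₀, h0⟩ := h0
      right
      by_cases h1 : ∃ i₁ j₁, i₁ ≠ i₀ ∧ U i₁ j₁ ≠ 0
      · obtain ⟨i₁, j₁, hi, h1⟩ := h1
        obtain rfl : j₀ = j₁ := by
          by_contra hj
          exact h hi.symm hj h0 h1
        right
        refine ⟨j₀, fun i => U i j₀, fun hz => h0 (congrFun hz i₀), ?_⟩
        ext1 i; ext1 j
        by_cases hj : j = j₀
        · subst hj; simp
        · rw [Pi.single_eq_of_ne hj]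
          by_contra hne
          have e0 : i₀ = i := by
            by_contra hi'
            exact h hi' (Ne.symm hj) h0 (Ne.symm hne)
          have e1 : i₁ = i := by
            by_contra hi'
            exact h hi' (Ne.symm hj) h1 (Ne.symm hne)
          exact hi (e1.trans e0.symm)
      · push Not at h1
        left
        refine ⟨i₀, U i₀, fun hz => h0 (congrFun hz j₀), ?_⟩
        ext1 i; ext1 j
        by_cases hi : i = i₀
        · subst hi; simp
        · rw [Pi.single_eq_of_ne hi, h1 i j hi]; rfl
    · push Not at h0
      left
      ext1 i; ext1 j
      exact h0 i j
  · rintro (rfl | ⟨a, v, -, rfl⟩ | ⟨b, v, -, rfl⟩) i i' j j' hi hj h1 h2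
    · exact h1 rfl
    · have e1 : i = a := by
        by_contra h; exact h1 (by rw [Pi.single_eq_of_ne h]; rfl)
      have e2 : i' = a := by
        by_contra h; exact h2 (by rw [Pi.single_eq_of_ne h]; rfl)
      exact hi (e1.trans e2.symm)
    · have e1 : j = b := by
        by_contra h; exact h1 (Pi.single_eq_of_ne h _)
      have e2 : j' = b := by
        by_contra h; exact h2 (Pi.single_eq_of_ne h _)
      exact hj (e1.trans e2.symm)

variable [Fintype α] [Fintype β] [Fintype Γ]

theorem card_ne_zero_fun [DecidableEq Γ] :
    (Finset.univ.filter fun v : β → Γ => v ≠ 0).card = Fintype.card Γ ^ Fintype.card β - 1 := by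
  rw [Finset.filter_ne', Finset.card_erase_of_mem (Finset.mem_univ _), Finset.card_univ,
    Fintype.card_fun]

/-- Inclusion–exclusion: besides zero, there are the matrices supported on one row and those
supported on one column; those with a single nonzero entry are counted twice. -/
theorem card_noGeneralPair : Nat.card {U : α → β → Γ // NoGeneralPair U} +
      Fintype.card α * (Fintype.card β * (Fintype.card Γ - 1)) =
    1 + (Fintype.card α * (Fintype.card Γ ^ Fintype.card β - 1) +
      Fintype.card β * (Fintype.card Γ ^ Fintype.card α - 1)) := by
  classical
  let A : Finset (α → β → Γ) := (Finset.univ ×ˢ Finset.univ.filter fun v : β → Γ => v ≠ 0).image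
    fun x : α × (β → Γ) => Pi.single x.1 x.2
  let B : Finset (α → β → Γ) := (Finset.univ ×ˢ Finset.univ.filter fun v : α → Γ => v ≠ 0).image
    fun x : β × (α → Γ) => fun a => Pi.single x.1 (x.2 a)
  let C : Finset (α → β → Γ) :=
    (Finset.univ ×ˢ Finset.univ ×ˢ Finset.univ.filter fun v : Γ => v ≠ 0).image
    fun x : α × β × Γ => Pi.single x.1 (Pi.single x.2.1 x.2.2)
  have memA : ∀ U, U ∈ A ↔ ∃ i, ∃ v : β → Γ, v ≠ 0 ∧ Pi.single i v = U := fun U => by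
    simp [A]
  have memB : ∀ U, U ∈ B ↔ ∃ j, ∃ v : α → Γ, v ≠ 0 ∧ (fun a => Pi.single j (v a)) = U :=
    fun U => by simp [B]
  have memC : ∀ U, U ∈ C ↔ ∃ i j, ∃ c : Γ, c ≠ 0 ∧ Pi.single i (Pi.single j c) = U := fun U => by
    simp [C]
  have hA : A.card = Fintype.card α * (Fintype.card Γ ^ Fintype.card β - 1) := by
    rw [Finset.card_image_of_injOn, Finset.card_product, card_ne_zero_fun, Finset.card_univ]
    rintro ⟨i, v⟩ hv ⟨i', v'⟩ hv' h
    simp only [Finset.coe_product, Set.mem_prod, Finset.mem_coe, Finset.mem_filter] at hv hv'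
    obtain rfl : i = i' := by
      by_contra hne
      have := congrFun h i
      simp only [Pi.single_eq_same, Pi.single_eq_of_ne hne] at this
      exact hv.2.2 this
    exact Prod.ext rfl (Pi.single_injective _ h)
  have hB : B.card = Fintype.card β * (Fintype.card Γ ^ Fintype.card α - 1) := by
    rw [Finset.card_image_of_injOn, Finset.card_product, card_ne_zero_fun, Finset.card_univ]
    rintro ⟨j, v⟩ hv ⟨j', v'⟩ hv' h
    simp only [Finset.coe_product, Set.mem_prod, Finset.mem_coe, Finset.mem_filter] at hv hv'
    obtain rfl : j = j' := by
      by_contra hne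
      refine hv.2.2 (funext fun a => ?_)
      have := congrFun (congrFun h a) j
      simp only [Pi.single_eq_same, Pi.single_eq_of_ne hne] at this
      exact this
    refine Prod.ext rfl (funext fun a => ?_)
    simpa using congrFun (congrFun h a) j
  have hC : C.card = Fintype.card α * (Fintype.card β * (Fintype.card Γ - 1)) := by
    rw [Finset.card_image_of_injOn, Finset.card_product, Finset.card_product, Finset.filter_ne',
      Finset.card_erase_of_mem (Finset.mem_univ _), Finset.card_univ, Finset.card_univ,
      Finset.card_univ]
    rintro ⟨i, j, c⟩ hv ⟨i', j', c'⟩ hv' h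
    simp only [Finset.coe_product, Set.mem_prod, Finset.mem_coe, Finset.mem_filter] at hv hv'
    have h' := congrFun (congrFun h i) j
    simp only [Pi.single_eq_same] at h'
    obtain rfl : i = i' := by
      by_contra hne
      rw [Pi.single_eq_of_ne hne] at h'
      exact hv.2.2.2 h'
    rw [Pi.single_eq_same] at h'
    obtain rfl : j = j' := by
      by_contra hne
      rw [Pi.single_eq_of_ne hne] at h'
      exact hv.2.2.2 h'
    rw [Pi.single_eq_same] at h'
    simp [h']
  have hAB : A ∩ B = C := by
    ext U
    rw [Finset.mem_inter, memA, memB, memC]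
    constructor
    · rintro ⟨⟨i, v, hv, rfl⟩, j, w, hw, h⟩
      have hvj : v = Pi.single j (w i) := by simpa using (congrFun h i).symm
      exact ⟨i, j, w i, fun h0 => hv (by rw [hvj, h0, Pi.single_zero]), by rw [hvj]⟩
    · rintro ⟨i, j, c, hc, rfl⟩
      refine ⟨⟨i, Pi.single j c, by simpa using hc, rfl⟩, j, Pi.single i c, by simpa using hc, ?_⟩
      ext1 a
      by_cases ha : a = i
      · subst ha; simp
      · simp [Pi.single_eq_of_ne ha]
  have h0 : (0 : α → β → Γ) ∉ A ∪ B := by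
    rw [Finset.mem_union, memA, memB]
    rintro (⟨i, v, hv, h⟩ | ⟨j, v, hv, h⟩)
    · exact hv (by simpa using h)
    · exact hv (funext fun a => by simpa using congrFun (congrFun h a) j)
  have hU : (Finset.univ.filter fun U : α → β → Γ => NoGeneralPair U) = insert 0 (A ∪ B) := by
    ext U
    rw [Finset.mem_filter, Finset.mem_insert, Finset.mem_union, memA, memB, noGeneralPair_iff]
    simp
  rw [Nat.card_eq_fintype_card, Fintype.card_subtype, hU, Finset.card_insert_of_notMem h0, ← hC,
    ← hAB, ← hA, ← hB, ← Finset.card_union_add_card_inter]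
  ring

end Block

/-- `U ↦ q - 1 - U` identifies the matrices over `{0, …, p}` with the zero-free ones over
`{0, …, p + 1}`. -/
def zeroFreeEquiv (p : ℕ) (α β : Type*) :
    {U : α → β → Fin (p + 1) // NoGeneralPair U} ≃
      {W : α → β → Fin (p + 2) // SwitchFree W ∧ ∀ i j, W i j ≠ 0} where
  toFun U := ⟨fun i j => (U.1 i j).castSucc.rev, fun i i' j j' hi hj h1 h2 _ _ =>
      U.2 hi hj (fun h => h1 (by simp [h])) (fun h => h2 (by simp [h])), fun i j h => by
      rw [Fin.rev_eq_iff, Fin.rev_zero] at h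
      exact (Fin.castSucc_lt_last _).ne h⟩
  invFun W := ⟨fun i j => (W.1 i j).rev.castPred fun h => W.2.2 i j (by
      rw [Fin.rev_eq_iff, Fin.rev_last] at h; exact h), fun i i' j j' hi hj h1 h2 =>
      W.2.1 hi hj (fun h => h1 (by simp [h])) (fun h => h2 (by simp [h])) (W.2.2 _ _) (W.2.2 _ _)⟩
  left_inv U := by ext; simp
  right_inv W := by ext; simp

theorem card_zeroFree {p : ℕ} (α β : Type*) [Fintype α] [Fintype β] :
    (Nat.card {W : α → β → Fin (p + 2) // SwitchFree W ∧ ∀ i j, W i j ≠ 0} : ℚ) =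
      blockCount (p + 2) (Fintype.card α) (Fintype.card β) := by
  classical
  have h := card_noGeneralPair (α := α) (β := β) (Γ := Fin (p + 1))
  rw [Nat.card_congr (zeroFreeEquiv p α β), Fintype.card_fin] at h
  have h1 : ∀ k, 1 ≤ (p + 1) ^ k := fun k => Nat.one_le_pow _ _ p.succ_pos
  have h' := congrArg (Nat.cast : ℕ → ℚ) h
  push_cast [Nat.cast_sub (h1 _), Nat.add_sub_cancel] at h'
  rw [blockCount]
  push_cast
  ring_nf at h' ⊢
  linarith

/-! ### The recursion -/

/-- The number of blocks with `r` rows and `s` columns; there are none without rows or columns. -/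
def blockCount₀ (q r s : ℕ) : ℚ := if 1 ≤ r ∧ 1 ≤ s then blockCount q r s else 0

theorem card_peel_fiber {p : ℕ} {α β : Type*} [Fintype α] [Fintype β] (R : Finset α)
    (S : Finset β) :
    (Nat.card {M : α → β → Fin (p + 2) //
        (SwitchFree M ∧ M ≠ 0) ∧ peelRows M = R ∧ peelCols M = S} : ℚ) =
      blockCount₀ (p + 2) R.card S.card *
        lonesumCount (p + 2) (Fintype.card α - R.card) (Fintype.card β - S.card) := by
  classical
  by_cases h : R.Nonempty ∧ S.Nonempty
  · rw [Nat.card_congr (peelEquiv h.1 h.2), Nat.card_prod, Nat.cast_mul, card_zeroFree,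
      card_switchFree, blockCount₀, if_pos ⟨h.1.card_pos, h.2.card_pos⟩]
    simp [Fintype.card_subtype_compl]
  · have : IsEmpty {M : α → β → Fin (p + 2) //
        (SwitchFree M ∧ M ≠ 0) ∧ peelRows M = R ∧ peelCols M = S} :=
      ⟨fun M => h ⟨M.2.2.1 ▸ M.2.1.1.peelRows_nonempty M.2.1.2,
        M.2.2.2 ▸ M.2.1.1.peelCols_nonempty M.2.1.2⟩⟩
    rw [Nat.card_of_isEmpty, blockCount₀, if_neg, Nat.cast_zero, zero_mul]
    exact fun h' => h ⟨Finset.card_pos.1 h'.1, Finset.card_pos.1 h'.2⟩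

theorem switchFree_zero {p : ℕ} {α β : Type*} : SwitchFree (0 : α → β → Fin (p + 2)) :=
  fun _ _ _ _ _ _ _ _ h _ => h rfl

/-- A nonzero lonesum matrix is given by its first block and the lonesum matrix outside the rows and
columns of that block. -/
theorem lonesumCount_recursion (p m n : ℕ) : (lonesumCount (p + 2) m n : ℚ) =
    1 + ∑ r ∈ Finset.range (m + 1), ∑ s ∈ Finset.range (n + 1),
      (m.choose r * n.choose s : ℚ) *
        (blockCount₀ (p + 2) r s * lonesumCount (p + 2) (m - r) (n - s)) := by
  classical
  have h1 : lonesumCount (p + 2) m n = 1 +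
      (Finset.univ.filter fun M : Fin m → Fin n → Fin (p + 2) => SwitchFree M ∧ M ≠ 0).card := by
    have := card_switchFree (p := p) (Fin m) (Fin n)
    rw [Fintype.card_fin, Fintype.card_fin] at this
    rw [← this, Nat.card_eq_fintype_card, Fintype.card_subtype]
    refine Eq.trans (congrArg Finset.card ?_) ((Finset.card_insert_of_notMem
      (a := (0 : Fin m → Fin n → Fin (p + 2))) (by simp)).trans (Nat.add_comm _ _))
    ext M
    simp only [Finset.mem_filter, Finset.mem_univ, true_and, Finset.mem_insert]
    by_cases hM : M = 0
    · subst hM; simp [switchFree_zero]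
    · simp [hM]
  rw [h1, Finset.card_eq_sum_card_fiberwise
    (f := fun M => (peelRows M, peelCols M)) (t := Finset.univ) (fun _ _ => Finset.mem_univ _),
    ← Finset.univ_product_univ, Finset.sum_product]
  push_cast
  congr 1
  have h2 : ∀ (R : Finset (Fin m)) (S : Finset (Fin n)),
      ((Finset.filter (fun M => (peelRows M, peelCols M) = (R, S))
        (Finset.univ.filter fun M : Fin m → Fin n → Fin (p + 2) => SwitchFree M ∧ M ≠ 0)).card : ℚ)
      = blockCount₀ (p + 2) R.card S.card * lonesumCount (p + 2) (m - R.card) (n - S.card) := by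
    intro R S
    have := card_peel_fiber (p := p) R S
    rw [Fintype.card_fin, Fintype.card_fin] at this
    rw [← this, Nat.card_eq_fintype_card, Fintype.card_subtype, Finset.filter_filter]
    simp only [Prod.mk.injEq]
  simp only [h2]
  have h3 : ∀ R : Finset (Fin m), ∑ S : Finset (Fin n), blockCount₀ (p + 2) R.card S.card *
      (lonesumCount (p + 2) (m - R.card) (n - S.card) : ℚ) =
      ∑ s ∈ Finset.range (n + 1), (n.choose s : ℚ) *
        (blockCount₀ (p + 2) R.card s * lonesumCount (p + 2) (m - R.card) (n - s)) := by
    intro R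
    have := Finset.sum_powerset_apply_card (x := (Finset.univ : Finset (Fin n))) fun s =>
      blockCount₀ (p + 2) R.card s * (lonesumCount (p + 2) (m - R.card) (n - s) : ℚ)
    simpa using this
  simp only [h3]
  have := Finset.sum_powerset_apply_card (x := (Finset.univ : Finset (Fin m))) fun r =>
    ∑ s ∈ Finset.range (n + 1), (n.choose s : ℚ) *
        (blockCount₀ (p + 2) r s * lonesumCount (p + 2) (m - r) (n - s))
  simpa [Finset.mul_sum, mul_assoc] using this

/-! ### Products of series in separate variables -/

theorem MvPowerSeries.coeff_mul_fin_two {R : Type*} [Semiring R] (f g : MvPowerSeries (Fin 2) R)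
    (d : Fin 2 →₀ ℕ) : coeff d (f * g) = ∑ a ∈ Finset.HasAntidiagonal.antidiagonal (d 0),
      ∑ b ∈ Finset.HasAntidiagonal.antidiagonal (d 1),
        coeff (Finsupp.equivFunOnFinite.symm ![a.1, b.1]) f *
          coeff (Finsupp.equivFunOnFinite.symm ![a.2, b.2]) g := by
  classical
  rw [coeff_mul, ← Finset.sum_product']
  refine Finset.sum_bij' (fun x _ => ((x.1 0, x.2 0), (x.1 1, x.2 1)))
    (fun y _ => (Finsupp.equivFunOnFinite.symm ![y.1.1, y.2.1],
      Finsupp.equivFunOnFinite.symm ![y.1.2, y.2.2])) ?_ ?_ ?_ ?_ ?_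
  · intro x hx
    rw [Finset.HasAntidiagonal.mem_antidiagonal] at hx
    simp [← hx]
  · intro y hy
    rw [Finset.mem_product, Finset.HasAntidiagonal.mem_antidiagonal,
      Finset.HasAntidiagonal.mem_antidiagonal] at hy
    rw [Finset.HasAntidiagonal.mem_antidiagonal]
    ext i
    fin_cases i
    · simpa using hy.1
    · simpa using hy.2
  · intro x _
    refine Prod.ext ?_ ?_ <;> ext i <;> fin_cases i <;> simp
  · intro y _
    simp
  · intro x _
    congr 2 <;> congr 1 <;> ext i <;> fin_cases i <;> simp

/-- The series `g(x) h(y)`. -/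
noncomputable def sepMul (g h : PowerSeries ℚ) : MvPowerSeries (Fin 2) ℚ :=
  fun d => PowerSeries.coeff (d 0) g * PowerSeries.coeff (d 1) h

theorem coeff_sepMul (g h : PowerSeries ℚ) (d : Fin 2 →₀ ℕ) :
    MvPowerSeries.coeff d (sepMul g h) = PowerSeries.coeff (d 0) g * PowerSeries.coeff (d 1) h :=
  rfl

theorem sepMul_mul_sepMul (g h g' h' : PowerSeries ℚ) :
    sepMul g h * sepMul g' h' = sepMul (g * g') (h * h') := by
  ext d
  rw [MvPowerSeries.coeff_mul_fin_two, coeff_sepMul, PowerSeries.coeff_mul, PowerSeries.coeff_mul,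
    Finset.sum_mul_sum]
  refine Finset.sum_congr rfl fun a _ => Finset.sum_congr rfl fun b _ => ?_
  simp only [coeff_sepMul, Finsupp.equivFunOnFinite_symm_apply_apply, Matrix.cons_val_zero,
    Matrix.cons_val_one]
  ring

theorem sepMul_add_left (g g' h : PowerSeries ℚ) :
    sepMul (g + g') h = sepMul g h + sepMul g' h := by
  ext d
  simp only [coeff_sepMul, map_add]
  ring

theorem sepMul_sub_left (g g' h : PowerSeries ℚ) :
    sepMul (g - g') h = sepMul g h - sepMul g' h := by
  ext d
  simp only [coeff_sepMul, map_sub]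
  ring

theorem sepMul_neg_left (g h : PowerSeries ℚ) : sepMul (-g) h = -sepMul g h := by
  ext d
  simp only [coeff_sepMul, map_neg]
  ring

theorem C_eq_sepMul (a : ℚ) : MvPowerSeries.C a = sepMul (PowerSeries.C a) 1 := by
  classical
  ext d
  rw [coeff_sepMul, MvPowerSeries.coeff_C, PowerSeries.coeff_C, PowerSeries.coeff_one]
  have : d = 0 ↔ d 0 = 0 ∧ d 1 = 0 := by
    rw [Finsupp.ext_iff, Fin.forall_fin_two]; rfl
  by_cases h0 : d 0 = 0 <;> by_cases h1 : d 1 = 0 <;> simp [this, h0, h1]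

theorem one_eq_sepMul : (1 : MvPowerSeries (Fin 2) ℚ) = sepMul 1 1 := by
  simpa using C_eq_sepMul 1

theorem X_zero_eq_sepMul : (MvPowerSeries.X 0 : MvPowerSeries (Fin 2) ℚ) =
    sepMul PowerSeries.X 1 := by
  classical
  ext d
  rw [coeff_sepMul, MvPowerSeries.coeff_X, PowerSeries.coeff_X, PowerSeries.coeff_one]
  have : d = Finsupp.single 0 1 ↔ d 0 = 1 ∧ d 1 = 0 := by
    rw [Finsupp.ext_iff, Fin.forall_fin_two]; simp
  by_cases h0 : d 0 = 1 <;> by_cases h1 : d 1 = 0 <;> simp [this, h0, h1]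

theorem X_one_eq_sepMul : (MvPowerSeries.X 1 : MvPowerSeries (Fin 2) ℚ) =
    sepMul 1 PowerSeries.X := by
  classical
  ext d
  rw [coeff_sepMul, MvPowerSeries.coeff_X, PowerSeries.coeff_X, PowerSeries.coeff_one]
  have : d = Finsupp.single 1 1 ↔ d 0 = 0 ∧ d 1 = 1 := by
    rw [Finsupp.ext_iff, Fin.forall_fin_two]; simp
  by_cases h0 : d 0 = 0 <;> by_cases h1 : d 1 = 1 <;> simp [this, h0, h1]

theorem sepMul_pow (g h : PowerSeries ℚ) (n : ℕ) : sepMul g h ^ n = sepMul (g ^ n) (h ^ n) := by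
  induction n with
  | zero => simpa using one_eq_sepMul
  | succ n ih => rw [pow_succ, ih, sepMul_mul_sepMul, ← pow_succ, ← pow_succ]

theorem coeff_expX (c : ℚ) (n : ℕ) : PowerSeries.coeff n (expX c) = c ^ n / n ! := by
  simp [expX, PowerSeries.coeff_rescale, PowerSeries.coeff_exp, div_eq_mul_inv]

theorem constantCoeff_expX (c : ℚ) : PowerSeries.constantCoeff (expX c) = 1 := by
  simp [← PowerSeries.coeff_zero_eq_constantCoeff_apply, coeff_expX]

theorem expX_zero : expX 0 = 1 := by
  ext n
  rw [coeff_expX, PowerSeries.coeff_one]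
  by_cases h : n = 0 <;> simp [h]

theorem expX_mul (a b : ℚ) : expX a * expX b = expX (a + b) :=
  PowerSeries.exp_mul_exp_eq_exp_add a b

theorem expX_pow (a : ℚ) (n : ℕ) : expX a ^ n = expX (n * a) := by
  induction n with
  | zero => simp [expX_zero]
  | succ n ih => rw [pow_succ, ih, expX_mul]; congr 1; push_cast; ring

theorem coeff_X_mul_expX (c : ℚ) (n : ℕ) :
    PowerSeries.coeff n (PowerSeries.X * expX c) = n * c ^ (n - 1) / n ! := by
  cases n with
  | zero => simp
  | succ n =>
    rw [PowerSeries.coeff_succ_X_mul, coeff_expX, Nat.factorial_succ, Nat.add_sub_cancel]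
    push_cast
    field_simp

theorem coeff_X_pow_mul_expX (c : ℚ) (k n : ℕ) :
    PowerSeries.coeff n (PowerSeries.X ^ k * expX c) =
      k ! * n.choose k * c ^ (n - k) / n ! := by
  rw [PowerSeries.coeff_X_pow_mul']
  split_ifs with h
  · rw [coeff_expX, ← Nat.choose_mul_factorial_mul_factorial h]
    have := Nat.choose_pos h
    push_cast
    field_simp
  · rw [Nat.choose_eq_zero_of_lt (not_le.1 h)]; simp

theorem expXY_eq_sepMul (a b : ℚ) : expXY a b = sepMul (expX a) (expX b) := by
  classical
  have hs : PowerSeries.HasSubst (MvPowerSeries.C a * MvPowerSeries.X 0 +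
      MvPowerSeries.C b * MvPowerSeries.X 1 : MvPowerSeries (Fin 2) ℚ) :=
    PowerSeries.HasSubst.of_constantCoeff_zero (by simp)
  -- only the power `d 0 + d 1` of the linear form contributes to the coefficient of `x^(d 0) y^(d 1)`
  have hpow : ∀ (n : ℕ) (d : Fin 2 →₀ ℕ), MvPowerSeries.coeff d ((MvPowerSeries.C a *
      MvPowerSeries.X 0 + MvPowerSeries.C b * MvPowerSeries.X 1 : MvPowerSeries (Fin 2) ℚ) ^ n) =
      if n = d 0 + d 1 then (n.choose (d 0) : ℚ) * a ^ d 0 * b ^ d 1 else 0 := by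
    intro n d
    have hmon : ∀ k, (MvPowerSeries.C a * MvPowerSeries.X 0 : MvPowerSeries (Fin 2) ℚ) ^ k *
        (MvPowerSeries.C b * MvPowerSeries.X 1) ^ (n - k) * (n.choose k : MvPowerSeries (Fin 2) ℚ)
        = sepMul (PowerSeries.C (a ^ k * b ^ (n - k) * n.choose k) * PowerSeries.X ^ k)
          (PowerSeries.X ^ (n - k)) := by
      intro k
      have : (n.choose k : MvPowerSeries (Fin 2) ℚ) = MvPowerSeries.C (n.choose k : ℚ) := by simp
      rw [this]
      simp only [C_eq_sepMul, X_zero_eq_sepMul, X_one_eq_sepMul, sepMul_mul_sepMul, sepMul_pow,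
        map_mul, map_pow]
      congr 1 <;> ring
    rw [add_pow, map_sum]
    simp only [hmon, coeff_sepMul, PowerSeries.coeff_C_mul, PowerSeries.coeff_X_pow]
    split_ifs with h
    · rw [Finset.sum_eq_single (d 0)]
      · rw [show n - d 0 = d 1 by omega]
        simp
        ring
      · intro k _ hk; simp [Ne.symm hk]
      · intro h'; exact absurd (Finset.mem_range.2 (by omega)) h'
    · refine Finset.sum_eq_zero fun k hk => ?_
      have := Finset.mem_range.1 hk
      by_cases h0 : d 0 = k
      · rw [if_neg (by omega : ¬ d 1 = n - k)]; simp
      · simp [h0]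
  ext d
  rw [expXY, PowerSeries.coeff_subst hs, coeff_sepMul, coeff_expX, coeff_expX,
    finsum_eq_single _ (d 0 + d 1) fun n hn => by rw [hpow, if_neg hn, smul_zero], hpow,
    if_pos rfl, PowerSeries.coeff_exp, Nat.choose_symm_add, Nat.add_choose]
  have h1 : ((d 0)! * (d 1)! : ℕ) ∣ (d 0 + d 1)! := Nat.factorial_mul_factorial_dvd_factorial_add _ _
  rw [Nat.cast_div h1 (by positivity)]
  simp only [smul_eq_mul, Algebra.algebraMap_self, RingHom.id_apply]
  push_cast
  field_simp

/-! ### The series of the blocks -/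

/-- The four factors in `x` in the decomposition of `F_q` by its dependence on `y`. -/
noncomputable def factorX (q : ℕ) : Fin 4 → PowerSeries ℚ :=
  ![1 - expX 1, -1 + expX 1 - PowerSeries.X * expX 1,
    (-1 - PowerSeries.C ((q : ℚ) - 2) * PowerSeries.X + expX ((q : ℚ) - 2)) * expX 1,
    PowerSeries.X * expX 1]

/-- The four factors in `y` in the decomposition of `F_q` by its dependence on `y`. -/
noncomputable def factorY (q : ℕ) : Fin 4 → PowerSeries ℚ :=
  ![1, expX 1, PowerSeries.X * expX 1, expX ((q : ℚ) - 1)]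

theorem lonesumF_eq_sum (q : ℕ) : lonesumF q = ∑ i, sepMul (factorX q i) (factorY q i) := by
  rw [Fin.sum_univ_four]
  simp only [lonesumF, factorX, factorY, expXY_eq_sepMul, expX_zero]
  simp only [Matrix.cons_val]
  rw [show ((q : ℚ) - 1) = ((q : ℚ) - 2) + 1 by ring]
  generalize (q : ℚ) - 2 = c
  have hC := C_eq_sepMul c
  rw [hC, X_zero_eq_sepMul, X_one_eq_sepMul, one_eq_sepMul]
  simp only [add_mul, sub_mul, sepMul_mul_sepMul, sepMul_add_left, sepMul_sub_left,
    sepMul_neg_left, neg_mul, one_mul, mul_one, mul_assoc, expX_mul]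
  abel

theorem coeff_lonesumF (q : ℕ) (d : Fin 2 →₀ ℕ) : MvPowerSeries.coeff d (lonesumF q) =
    blockCount₀ q (d 0) (d 1) / ((d 0)! * (d 1)!) := by
  rw [lonesumF_eq_sum, Fin.sum_univ_four]
  simp only [factorX, factorY, Matrix.cons_val, map_add, coeff_sepMul]
  generalize d 0 = m
  generalize d 1 = n
  have e : ((q : ℚ) - 1) = ((q : ℚ) - 2) + 1 := by ring
  have h1 : ∀ k : ℕ, PowerSeries.coeff k (1 : PowerSeries ℚ) = (if k = 0 then 1 else 0) / k ! := by
    intro k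
    rw [PowerSeries.coeff_one]
    by_cases hk : k = 0 <;> simp [hk]
  simp only [add_mul, sub_mul, neg_mul, one_mul, mul_assoc, expX_mul, map_add, map_sub, map_neg,
    PowerSeries.coeff_C_mul, coeff_X_mul_expX, coeff_expX, one_pow, mul_one, h1, ← e]
  rw [blockCount₀, blockCount]
  have hm : (m ! : ℚ) ≠ 0 := by positivity
  have hn : (n ! : ℚ) ≠ 0 := by positivity
  field_simp
  by_cases hm0 : m = 0
  · subst hm0
    by_cases hn0 : n = 0
    · subst hn0; simp
    · simp [hn0]
  · by_cases hn0 : n = 0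
    · subst hn0; simp [hm0]; ring
    · rw [if_neg hm0, if_neg hn0, if_pos ⟨Nat.pos_of_ne_zero hm0, Nat.pos_of_ne_zero hn0⟩]
      ring

/-! ### Geometric series -/

/-- If `F` is divisible by `x`, then the coefficients of `F ^ K * G` vanish below degree `K` in
`x`. -/
theorem coeff_pow_mul_eq_zero {F : MvPowerSeries (Fin 2) ℚ}
    (hF : ∀ d : Fin 2 →₀ ℕ, d 0 = 0 → MvPowerSeries.coeff d F = 0)
    (G : MvPowerSeries (Fin 2) ℚ) (K : ℕ) : ∀ d : Fin 2 →₀ ℕ, d 0 < K →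
      MvPowerSeries.coeff d (F ^ K * G) = 0 := by
  induction K with
  | zero => intro d hd; omega
  | succ K ih =>
    intro d hd
    rw [pow_succ', mul_assoc, MvPowerSeries.coeff_mul]
    refine Finset.sum_eq_zero fun x hx => ?_
    have hx' : x.1 0 + x.2 0 = d 0 := by
      rw [← Finset.HasAntidiagonal.mem_antidiagonal.1 hx]; rfl
    by_cases h0 : x.1 0 = 0
    · rw [hF _ h0, zero_mul]
    · rw [ih x.2 (by omega), mul_zero]

theorem coeff_eq_sum_of_one_sub_mul_eq {F G E : MvPowerSeries (Fin 2) ℚ}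
    (hF : ∀ d : Fin 2 →₀ ℕ, d 0 = 0 → MvPowerSeries.coeff d F = 0) (h : (1 - F) * G = E)
    (d : Fin 2 →₀ ℕ) : MvPowerSeries.coeff d G =
      ∑ N ∈ Finset.range (d 0 + 1), MvPowerSeries.coeff d (F ^ N * E) := by
  have hG : G = (∑ N ∈ Finset.range (d 0 + 1), F ^ N * E) + F ^ (d 0 + 1) * G := by
    rw [← Finset.sum_mul, ← h, ← mul_assoc, geom_sum_mul_neg]
    ring
  conv_lhs => rw [hG]
  rw [map_add, coeff_pow_mul_eq_zero hF G _ d (Nat.lt_succ_self _), add_zero, map_sum]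

/-! ### The generating function of the lonesum matrices -/

theorem lonesumF_eq_zero_of_left (q : ℕ) (d : Fin 2 →₀ ℕ) (h : d 0 = 0) :
    MvPowerSeries.coeff d (lonesumF q) = 0 := by
  rw [coeff_lonesumF, blockCount₀, if_neg (by omega), zero_div]

theorem coeff_lonesumEGF (q : ℕ) (d : Fin 2 →₀ ℕ) : MvPowerSeries.coeff d (lonesumEGF q) =
    (lonesumCount q (d 0) (d 1) : ℚ) / ((d 0)! * (d 1)!) := rfl

theorem one_sub_lonesumF_mul_lonesumEGF {q : ℕ} (hq : 2 ≤ q) :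
    (1 - lonesumF q) * lonesumEGF q = expXY 1 1 := by
  obtain ⟨p, rfl⟩ := Nat.exists_eq_add_of_le' hq
  rw [sub_mul, one_mul, sub_eq_iff_eq_add]
  ext d
  rw [map_add, MvPowerSeries.coeff_mul_fin_two, expXY_eq_sepMul, coeff_sepMul, coeff_expX,
    coeff_expX, coeff_lonesumEGF, lonesumCount_recursion, add_div, one_pow, one_pow, Finset.sum_div,
    Finset.Nat.sum_antidiagonal_eq_sum_range_succ_mk, div_mul_div_comm, one_mul]
  congr 1
  refine Finset.sum_congr rfl fun r hr => ?_
  rw [Finset.sum_div, Finset.Nat.sum_antidiagonal_eq_sum_range_succ_mk]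
  refine Finset.sum_congr rfl fun s hs => ?_
  have hr' : r ≤ d 0 := by have := Finset.mem_range.1 hr; omega
  have hs' : s ≤ d 1 := by have := Finset.mem_range.1 hs; omega
  simp only [coeff_lonesumF, coeff_lonesumEGF, Finsupp.equivFunOnFinite_symm_apply_apply,
    Matrix.cons_val_zero, Matrix.cons_val_one]
  rw [← Nat.choose_mul_factorial_mul_factorial hr', ← Nat.choose_mul_factorial_mul_factorial hs']
  have h1 := Nat.choose_pos hr'
  have h2 := Nat.choose_pos hs'
  push_cast
  field_simp

theorem constantCoeff_one_sub_lonesumF (q : ℕ) :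
    MvPowerSeries.constantCoeff (1 - lonesumF q) = 1 := by
  rw [map_sub, map_one, ← MvPowerSeries.coeff_zero_eq_constantCoeff_apply,
    lonesumF_eq_zero_of_left q 0 rfl, sub_zero]

theorem lonesumEGF_eq {q : ℕ} (hq : 2 ≤ q) :
    lonesumEGF q = expXY 1 1 * (1 - lonesumF q)⁻¹ := by
  rw [MvPowerSeries.eq_mul_inv_iff_mul_eq (by rw [constantCoeff_one_sub_lonesumF]; exact one_ne_zero),
    mul_comm, one_sub_lonesumF_mul_lonesumEGF hq]

/-! ### The expansion for a fixed number of columns -/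

/-- In the multinomial expansion of `F_q ^ N e^{x+y}` the term with index `l` is a product `g(x) h(y)`
with `h(y) = y^{l₃} e^{(1 + l₂ + l₃ + (q-1) l₄) y}`; its `y ^ k` coefficient, times `k!`, supplies the
scalar factors of `expansionTerm` other than the multinomial coefficient. -/
theorem coeff_pow_mul_expXY (q N : ℕ) (d : Fin 2 →₀ ℕ) :
    MvPowerSeries.coeff d (lonesumF q ^ N * expXY 1 1) =
      ∑ l ∈ Finset.univ.piAntidiag N, PowerSeries.coeff (d 0) (expansionTerm q (d 1) l) / (d 1)! := by
  rw [lonesumF_eq_sum, Finset.sum_pow_eq_sum_piAntidiag, Finset.sum_mul, map_sum]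
  refine Finset.sum_congr rfl fun l _ => ?_
  have hN : (Nat.multinomial Finset.univ l : MvPowerSeries (Fin 2) ℚ) =
      sepMul (PowerSeries.C (Nat.multinomial Finset.univ l : ℚ)) 1 := by
    rw [← C_eq_sepMul]; simp
  have hx : PowerSeries.C (Nat.multinomial Finset.univ l : ℚ) *
      (factorX q 0 ^ l 0 * factorX q 1 ^ l 1 * factorX q 2 ^ l 2 * factorX q 3 ^ l 3) * expX 1 =
      PowerSeries.C (Nat.multinomial Finset.univ l : ℚ) * ((1 - expX 1) ^ l 0
        * (-1 + expX 1 - PowerSeries.X * expX 1) ^ l 1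
        * (-1 - PowerSeries.C ((q : ℚ) - 2) * PowerSeries.X + expX ((q : ℚ) - 2)) ^ l 2
        * PowerSeries.X ^ l 3 * expX ((l 2 : ℚ) + (l 3 : ℚ) + 1)) := by
    have : expX ((l 2 : ℚ) + (l 3 : ℚ) + 1) = expX 1 ^ l 2 * expX 1 ^ l 3 * expX 1 := by
      rw [expX_pow, expX_pow, expX_mul, expX_mul, mul_one, mul_one]
    rw [this]
    simp only [factorX, Matrix.cons_val, mul_pow]
    ring
  have hy : factorY q 0 ^ l 0 * factorY q 1 ^ l 1 * factorY q 2 ^ l 2 * factorY q 3 ^ l 3 * expX 1 =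
      PowerSeries.X ^ l 2 * expX (1 + (l 1 : ℚ) + (l 2 : ℚ) + ((q : ℚ) - 1) * (l 3 : ℚ)) := by
    have : expX (1 + (l 1 : ℚ) + (l 2 : ℚ) + ((q : ℚ) - 1) * (l 3 : ℚ)) =
        expX 1 * expX 1 ^ l 1 * expX 1 ^ l 2 * expX ((q : ℚ) - 1) ^ l 3 := by
      rw [expX_pow, expX_pow, expX_pow, expX_mul, expX_mul, expX_mul]
      congr 1
      ring
    rw [this]
    simp only [factorY, Matrix.cons_val]
    ring
  rw [Fin.prod_univ_four, hN, expXY_eq_sepMul]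
  simp only [sepMul_pow, sepMul_mul_sepMul]
  rw [hx, one_mul, hy, coeff_sepMul, PowerSeries.coeff_C_mul, coeff_X_pow_mul_expX]
  simp only [expansionTerm, mul_assoc, PowerSeries.coeff_C_mul]
  ring

theorem coeff_expansionTerm_eq_zero_of_lt {q k : ℕ} {l : Fin 4 → ℕ} (h : k < l 2) (m : ℕ) :
    PowerSeries.coeff m (expansionTerm q k l) = 0 := by
  simp [expansionTerm, Nat.choose_eq_zero_of_lt h]

/-- The term with index `l` is divisible by `x ^ (l₁ + l₂ + l₃ + l₄)`. -/
theorem coeff_expansionTerm_eq_zero_of_sum {q k : ℕ} {l : Fin 4 → ℕ} {m : ℕ} (h : m < ∑ i, l i) :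
    PowerSeries.coeff m (expansionTerm q k l) = 0 := by
  have hX : ∀ f : PowerSeries ℚ, PowerSeries.coeff 0 f = 0 → PowerSeries.X ∣ f := fun f hf =>
    PowerSeries.X_dvd_iff.2 (by rwa [← PowerSeries.coeff_zero_eq_constantCoeff_apply])
  have h0 : (PowerSeries.X : PowerSeries ℚ) ∣ 1 - expX 1 := hX _ (by simp [constantCoeff_expX])
  have h1 : (PowerSeries.X : PowerSeries ℚ) ∣ -1 + expX 1 - PowerSeries.X * expX 1 :=
    hX _ (by simp [constantCoeff_expX])
  have h2 : (PowerSeries.X : PowerSeries ℚ) ∣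
      -1 - PowerSeries.C ((q : ℚ) - 2) * PowerSeries.X + expX ((q : ℚ) - 2) :=
    hX _ (by simp [constantCoeff_expX])
  refine PowerSeries.X_pow_dvd_iff.1 ?_ m h
  rw [Fin.sum_univ_four, pow_add, pow_add, pow_add]
  exact Dvd.dvd.mul_right (mul_dvd_mul (mul_dvd_mul (mul_dvd_mul (Dvd.dvd.mul_left
    (pow_dvd_pow_of_dvd h0 _) _) (pow_dvd_pow_of_dvd h1 _)) (pow_dvd_pow_of_dvd h2 _)) dvd_rfl) _

theorem formalHasSum_expansionTerm {q : ℕ} (hq : 2 ≤ q) (k : ℕ) :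
    FormalHasSum (fun l : {l : Fin 4 → ℕ // l 2 ≤ k} => expansionTerm q k l)
      (PowerSeries.mk fun m => (lonesumCount q m k : ℚ) / (m ! : ℚ)) := by
  classical
  intro m
  -- the indices whose terms can contribute to the coefficient of `x ^ m`
  let T : Finset (Fin 4 → ℕ) := (Finset.range (m + 1)).biUnion fun N => Finset.univ.piAntidiag N
  have hT : (Function.support fun l => PowerSeries.coeff m (expansionTerm q k l)) ⊆ T := by
    intro l hl
    have : ∑ i, l i ≤ m := by
      by_contra h
      exact hl (coeff_expansionTerm_eq_zero_of_sum (not_le.1 h))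
    simpa [T] using Nat.lt_succ_of_le this
  refine ⟨(T.finite_toSet.subset hT).preimage Subtype.val_injective.injOn, ?_⟩
  have hsub : ∑ᶠ l : {l : Fin 4 → ℕ // l 2 ≤ k}, PowerSeries.coeff m (expansionTerm q k l) =
      ∑ᶠ l, PowerSeries.coeff m (expansionTerm q k l) := by
    rw [finsum_subtype_eq_finsum_cond
      (f := fun l => PowerSeries.coeff m (expansionTerm q k l)) fun l => l 2 ≤ k]
    refine finsum_congr fun l => ?_
    by_cases h : l 2 ≤ k
    · simp [h]
    · simp [h, coeff_expansionTerm_eq_zero_of_lt (not_le.1 h)]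
  rw [hsub, finsum_eq_sum_of_support_subset _ hT, Finset.sum_biUnion, PowerSeries.coeff_mk]
  · have h := coeff_eq_sum_of_one_sub_mul_eq (lonesumF_eq_zero_of_left q)
      (one_sub_lonesumF_mul_lonesumEGF hq) (Finsupp.equivFunOnFinite.symm ![m, k])
    simp only [coeff_pow_mul_expXY, coeff_lonesumEGF, Finsupp.equivFunOnFinite_symm_apply_apply,
      Matrix.cons_val_zero, Matrix.cons_val_one, ← Finset.sum_div] at h
    have hk : (k ! : ℚ) ≠ 0 := by positivity
    rw [← div_div] at h
    exact ((div_left_inj' hk).1 h).symm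
  · intro N _ N' _ hN
    refine Finset.disjoint_left.2 fun l hl hl' => hN ?_
    rw [← (Finset.mem_piAntidiag.1 hl).1, (Finset.mem_piAntidiag.1 hl').1]

/-! ### Poly-Bernoulli numbers -/

theorem one_sub_lonesumF_two : 1 - lonesumF 2 = expXY 1 0 + expXY 0 1 - expXY 1 1 := by
  have h : expXY 0 0 = 1 := by
    rw [expXY_eq_sepMul, expX_zero, ← one_eq_sepMul]
  simp only [lonesumF, Nat.cast_ofNat, sub_self, h, map_zero]
  ring

/-- With `z = 1 - e^{-x}`, the identity `e^x + e^y - e^{x+y} = e^x (1 - z e^y)` turns Kaneko's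
quotient into the geometric series `∑ z^l e^{(l+1)y}`. -/
theorem lonesumCount_two (m n : ℕ) : (lonesumCount 2 m n : ℚ) = polyBernoulli m (-(n : ℤ)) := by
  have hz0 : PowerSeries.coeff 0 (1 - expX (-1)) = 0 := by simp [constantCoeff_expX]
  have hz : PowerSeries.HasSubst (1 - expX (-1)) :=
    PowerSeries.HasSubst.of_constantCoeff_zero'
      (by rwa [← PowerSeries.coeff_zero_eq_constantCoeff_apply])
  have hzl : ∀ l, m < l → PowerSeries.coeff m ((1 - expX (-1)) ^ l) = 0 := fun l hl =>
    PowerSeries.X_pow_dvd_iff.1 (pow_dvd_pow_of_dvd (PowerSeries.X_dvd_iff.2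
      (by rwa [← PowerSeries.coeff_zero_eq_constantCoeff_apply])) l) m hl
  have hF : ∀ d : Fin 2 →₀ ℕ, d 0 = 0 →
      MvPowerSeries.coeff d (sepMul (1 - expX (-1)) (expX 1)) = 0 := fun d hd => by
    rw [coeff_sepMul, hd, hz0, zero_mul]
  have heq : (1 - sepMul (1 - expX (-1)) (expX 1)) * lonesumEGF 2 = sepMul 1 (expX 1) := by
    have h := congrArg (sepMul (expX (-1)) 1 * ·) (one_sub_lonesumF_mul_lonesumEGF le_rfl)
    simp only [one_sub_lonesumF_two, expXY_eq_sepMul, ← mul_assoc, mul_add, mul_sub,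
      sepMul_mul_sepMul, expX_mul, expX_zero, one_mul, mul_one, neg_add_cancel] at h
    rw [← h, sepMul_sub_left, one_eq_sepMul]
    congr 1
    ring
  have h := coeff_eq_sum_of_one_sub_mul_eq hF heq (Finsupp.equivFunOnFinite.symm ![m, n])
  simp only [sepMul_pow, sepMul_mul_sepMul, coeff_sepMul, coeff_lonesumEGF, expX_pow, expX_mul,
    coeff_expX, Finsupp.equivFunOnFinite_symm_apply_apply, Matrix.cons_val_zero,
    Matrix.cons_val_one, mul_one, ← mul_div_assoc, ← Finset.sum_div] at h
  rw [← div_div, div_left_inj' (by positivity), div_eq_iff (by positivity)] at h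
  rw [h, polyBernoulli, polyBernoulliSeries, PowerSeries.coeff_subst' hz,
    finsum_eq_sum_of_support_subset (s := Finset.range (m + 1)), mul_comm]
  · congr 1
    refine Finset.sum_congr rfl fun l _ => ?_
    simp [polylog, mul_comm]
  · intro l hl
    by_contra hlm
    exact hl (by
      have : m < l := by simpa using hlm
      simp [hzl l this])

theorem mainTheorem5 :
    (∀ q : ℕ, 2 ≤ q →
      -- `F_q = ∑_{r,s ≥ 1} f_q(r,s) x^r/r! y^s/s!`
      (∀ d : Fin 2 →₀ ℕ, MvPowerSeries.coeff d (lonesumF q) =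
        if 1 ≤ d 0 ∧ 1 ≤ d 1 then blockCount q (d 0) (d 1) / ((d 0)! * (d 1)!) else 0) ∧
      -- `∑_{m,n} B_m^{(-n)}(q) x^m/m! y^n/n! = e^{x+y} / (1 - F_q)`
      IsUnit (1 - lonesumF q) ∧
      lonesumEGF q = expXY 1 1 * (1 - lonesumF q)⁻¹ ∧
      -- the expansion of `∑_m B_m^{(-k)}(q) x^m/m!`
      (∀ k : ℕ, FormalHasSum (fun l : {l : Fin 4 → ℕ // l 2 ≤ k} => expansionTerm q k l)
        (PowerSeries.mk fun m => (lonesumCount q m k : ℚ) / (m ! : ℚ)))) ∧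
    -- the case `q = 2`: Kaneko's formulas for the poly-Bernoulli numbers
    1 - lonesumF 2 = expXY 1 0 + expXY 0 1 - expXY 1 1 ∧
    lonesumEGF 2 = expXY 1 1 * (expXY 1 0 + expXY 0 1 - expXY 1 1)⁻¹ ∧
    (∀ m n : ℕ, (lonesumCount 2 m n : ℚ) = polyBernoulli m (-(n : ℤ))) := by
  refine ⟨fun q hq => ⟨fun d => ?_, ?_, lonesumEGF_eq hq, formalHasSum_expansionTerm hq⟩,
    one_sub_lonesumF_two, ?_, lonesumCount_two⟩
  · rw [coeff_lonesumF, blockCount₀, ite_div, zero_div]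
  · rw [MvPowerSeries.isUnit_iff_constantCoeff, constantCoeff_one_sub_lonesumF]
    exact isUnit_one
  · rw [← one_sub_lonesumF_two]
    exact lonesumEGF_eq le_rfl
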